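/- Let $N\ge 1$, let $\Omega\subset\mathbb R^N$ be a bounded open set with Lipschitz boundary (near each boundary point, in suitable orthonormal coordinates, $\Omega$ is the set of points strictly above the graph of a Lipschitz function), let $0<s<1$ and $r\in(1,\infty]$, and let $f\in L^r(\Omega)$. For each $n\in\mathbb N$ let $G_n:\mathbb R\to\mathbb R$ be a differentiable Orlicz function, that is: $G_n$ is even, convex, strictly increasing on $(0,\infty)$, $G_n(0)=0$, there is $C_n>2$ with $G_n(2t)\le C_nG_n(t)$ for all $t>0$, and $G_n(t)/t\to0$ as $t\to0$, $G_n(t)/t\to\infty$ as $t\to\infty$. Put $g_n=G_n'$ and assume that there are numbers $p_n^\pm$ and $\beta>1$ with $$0<p_n^-\le \frac{t\,g_n(t)}{G_n(t)}\le p_n^+\quad(t>0),\qquad p_n^+\le\beta p_n^-,\qquad p_n^-\to\infty ,$$ and that the $G_n$ are normalized so that $G_n(1)^{1/p_n^-}\to1$ (for instance $G_n(1)=1$ for all $n$; if $G_n(t)=|t|^{p_n}/p_n$, one can take $p_n^\pm=p_n$). Write $D^su(x,y)=\dfrac{u(x)-u(y)}{|x-y|^s}$ and $d\mu=\dfrac{dx\,dy}{|x-y|^N}$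 on $\mathbb R^N\times\mathbb R^N$. Let $W_0^{s,G_n}(\Omega)$ be the set of measurable $u:\mathbb R^N\to\mathbb R$ with $\int_{\mathbb R^N}G_n(u)\,dx<\infty$, $\iint G_n(D^su)\,d\mu<\infty$ and $u=0$ a.e. in $\mathbb R^N\setminus\Omega$. For all sufficiently large $n$ let $u_n$ be a weak solution of $(-\Delta_{g_n})^su_n=f$ in $\Omega$, $u_n=0$ in $\mathbb R^N\setminus\Omega$; that is, $u_n\in W_0^{s,G_n}(\Omega)$ is both a weak supersolution and a weak subsolution, meaning that $\iint g_n(D^su_n)\,D^sv\,d\mu\ge\int_\Omega fv\,dx$ (respectively $\le$) for every $v\in W_0^{s,G_n}(\Omega)$ with $v\ge0$ a.e. Then there are a subsequence $(u_{n_k})_k$ and a function $u_\infty\in C^{0,s}(\mathbb R^N)$ (bounded, with finite Hölder seminorm of order $s$) such that each $u_{n_k}$ coincides a.e. with a continuous function on $\mathbb R^N$ that vanishes in $\mathbb R^N\setminus\Omega$, and these continuous representatives converge to $u_\infty$ uniformly in $\mathbb R^N$. Moreover $u_\infty=0$ in $\mathbb R^N\setminus\Omega$ and $$[u_\infty]_{C^{0,s}}:=\sup_{x\ne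 y}\frac{|u_\infty(x)-u_\infty(y)|}{|x-y|^s}=\|D^su_\infty\|_{L^\infty(\mathbb R^N\times\mathbb R^N,\,d\mu)}\le1 .$$ -/

import Mathlib

open MeasureTheory Filter Topology
open scoped ENNReal NNReal

noncomputable section

namespace FracOrlicz

/-- Orlicz functions: even, continuous, convex, increasing on `(0, ∞)`, zero at `0`, with the
`Δ₂` condition, sublinear at `0` and superlinear at `∞`. -/
structure IsOrlicz (G : ℝ → ℝ) : Prop where
  even : ∀ t, G (-t) = G t
  continuous : Continuous G
  convex : ConvexOn ℝ Set.univ G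
  increasing : StrictMonoOn G (Set.Ioi 0)
  zero : G 0 = 0
  delta_two : ∃ C : ℝ, 2 < C ∧ ∀ t, 0 < t → G (2 * t) ≤ C * G t
  lim_zero : Tendsto (fun x => G x / x) (𝓝[≠] 0) (𝓝 0)
  lim_infty : Tendsto (fun x => G x / x) atTop atTop

/-- The growth condition `0 < p⁻ ≤ t g(t) / G(t) ≤ p⁺` for `t > 0`, where `g = G'`. -/
structure HasGrowth (G : ℝ → ℝ) (pm pp : ℝ) : Prop where
  differentiable : Differentiable ℝ G
  pos : 0 < pm
  lower : ∀ t, 0 < t → pm ≤ t * deriv G t / G t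
  upper : ∀ t, 0 < t → t * deriv G t / G t ≤ pp

variable {N : ℕ}

/-- The Hölder quotient `D^s u (x, y) = (u x - u y) / |x - y|^s`. -/
def holderQuotient (s : ℝ) (u : EuclideanSpace ℝ (Fin N) → ℝ)
    (z : EuclideanSpace ℝ (Fin N) × EuclideanSpace ℝ (Fin N)) : ℝ :=
  (u z.1 - u z.2) / ‖z.1 - z.2‖ ^ s

/-- The measure `dμ = dx dy / |x - y|^N` on `ℝ^N × ℝ^N`. -/
def mu (N : ℕ) : Measure (EuclideanSpace ℝ (Fin N) × EuclideanSpace ℝ (Fin N)) :=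
  ((volume : Measure (EuclideanSpace ℝ (Fin N))).prod volume).withDensity
    (fun z => ENNReal.ofReal (1 / ‖z.1 - z.2‖ ^ N))

/-- The modular `Φ_G(u) = ∫ G(u) dx`. -/
def modular (G : ℝ → ℝ) (u : EuclideanSpace ℝ (Fin N) → ℝ) : ℝ≥0∞ :=
  ∫⁻ x, ENNReal.ofReal (G (u x))

/-- The modular `Φ_{s,G}(u) = ∬ G(D^s u) dμ`. -/
def fracModular (s : ℝ) (G : ℝ → ℝ) (u : EuclideanSpace ℝ (Fin N) → ℝ) : ℝ≥0∞ :=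
  ∫⁻ z, ENNReal.ofReal (G (holderQuotient s u z)) ∂(mu N)

/-- Membership in the fractional Orlicz-Sobolev space `W^{s,G}(ℝ^N)`. -/
structure MemW (s : ℝ) (G : ℝ → ℝ) (u : EuclideanSpace ℝ (Fin N) → ℝ) : Prop where
  aemeasurable : AEMeasurable u volume
  modular_lt_top : modular G u < ∞
  fracModular_lt_top : fracModular s G u < ∞

/-- Membership in `W_0^{s,G}(Ω)`: functions of `W^{s,G}(ℝ^N)` that vanish a.e. outside `Ω`. -/
def MemW0 (s : ℝ) (G : ℝ → ℝ) (Ω : Set (EuclideanSpace ℝ (Fin N)))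
    (u : EuclideanSpace ℝ (Fin N) → ℝ) : Prop :=
  MemW s G u ∧ ∀ᵐ x ∂volume, x ∉ Ω → u x = 0

/-- The pairing `⟨(-Δ_g)^s u, v⟩ = ∬ g(D^s u) D^s v dμ` with `g = G'`. -/
def fracLapPairing (s : ℝ) (G : ℝ → ℝ) (u v : EuclideanSpace ℝ (Fin N) → ℝ) : ℝ :=
  ∫ z, deriv G (holderQuotient s u z) * holderQuotient s v z ∂(mu N)

/-- Weak supersolutions of `(-Δ_g)^s u = f` in `Ω`, `u = 0` outside `Ω`. -/
def IsWeakSupersolution (s : ℝ) (G : ℝ → ℝ) (Ω : Set (EuclideanSpace ℝ (Fin N)))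
    (f u : EuclideanSpace ℝ (Fin N) → ℝ) : Prop :=
  MemW0 s G Ω u ∧ ∀ v, MemW0 s G Ω v → (∀ᵐ x ∂volume, 0 ≤ v x) →
    ∫ x in Ω, f x * v x ≤ fracLapPairing s G u v

/-- Weak subsolutions of `(-Δ_g)^s u = f` in `Ω`, `u = 0` outside `Ω`. -/
def IsWeakSubsolution (s : ℝ) (G : ℝ → ℝ) (Ω : Set (EuclideanSpace ℝ (Fin N)))
    (f u : EuclideanSpace ℝ (Fin N) → ℝ) : Prop :=
  MemW0 s G Ω u ∧ ∀ v, MemW0 s G Ω v → (∀ᵐ x ∂volume, 0 ≤ v x) →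
    fracLapPairing s G u v ≤ ∫ x in Ω, f x * v x

/-- Weak solutions: both weak super- and weak subsolutions. -/
def IsWeakSolution (s : ℝ) (G : ℝ → ℝ) (Ω : Set (EuclideanSpace ℝ (Fin N)))
    (f u : EuclideanSpace ℝ (Fin N) → ℝ) : Prop :=
  IsWeakSupersolution s G Ω f u ∧ IsWeakSubsolution s G Ω f u

/-- `Ω` has Lipschitz boundary: near each boundary point, in suitable orthogonal coordinates
`y ↦ (y', t)` with `t = ⟪y, e⟫` and `y' = y - ⟪y, e⟫ e ∈ e^⊥`, `Ω` is the set of points strictly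
above the graph `t = γ(y')` of a Lipschitz function. -/
def HasLipschitzBoundary (Ω : Set (EuclideanSpace ℝ (Fin N))) : Prop :=
  ∀ x ∈ frontier Ω, ∃ (e : EuclideanSpace ℝ (Fin N)) (γ : EuclideanSpace ℝ (Fin N) → ℝ)
    (L : ℝ≥0) (ρ : ℝ), ‖e‖ = 1 ∧ LipschitzWith L γ ∧ 0 < ρ ∧
      ∀ y ∈ Metric.ball x ρ, y ∈ Ω ↔ γ (y - inner ℝ y e • e) < inner ℝ y e

/-- The Hölder seminorm `sup_{x ≠ y} |u x - u y| / |x - y|^s`, with values in `[0, ∞]`. -/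
def holderSeminorm (s : ℝ) (u : EuclideanSpace ℝ (Fin N) → ℝ) : ℝ≥0∞ :=
  ⨆ (x : EuclideanSpace ℝ (Fin N)) (y : EuclideanSpace ℝ (Fin N)) (_ : x ≠ y),
    ENNReal.ofReal (|u x - u y| / ‖x - y‖ ^ s)

/-- The space `C^{0,s}(ℝ^N)`: bounded functions with finite Hölder seminorm. -/
def MemHolderSpace (s : ℝ) (u : EuclideanSpace ℝ (Fin N) → ℝ) : Prop :=
  (∃ C : ℝ, ∀ x, |u x| ≤ C) ∧ holderSeminorm s u < ∞

end FracOrlicz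

end

/-! Write `E n` for the energy of `u n`, the integral of `G n (D^s u n)` against `mu N`. The heart
of the matter is that `E n → 0`.

Testing the equation with the positive and negative parts of `u n` gives `pm n * E n ≤ 2 ‖u n‖_∞
‖f‖_{L¹}` (`IsWeakSolution.energy_le`). The sup norm is controlled by the energy through a Morrey
estimate: once `pm n ≥ 2N/s`, `G n` dominates a fixed power of large arguments, and comparing ball
averages gives a continuous representative with modulus `H (1 + E n) |x - y|^(s/2)` for `|x - y| ≤
1`, where `H` depends only on `N` and `s`. Since it vanishes outside the bounded set `Ω`, it is
bounded by a multiple of `1 + E n`. Hence `pm n * E n ≤ B (1 + E n)` with `B` fixed, and as `pm n →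
∞` the right side is absorbed: `E n ≤ 2B / pm n`.

The Hölder bounds are now uniform, and Arzelà–Ascoli yields a uniform limit. If its quotient
exceeded `c > 1` at a point, `G n (D^s u n)` would eventually be at least `1` there, because `G n
(t) ≥ (|t|/c)^(pm n)` for `|t| ≥ c` and large `n`. Fatou and `E n → 0` confine such points to a null
set. Continuity off the diagonal turns this a.e. bound into a bound on the Hölder seminorm. -/

namespace FracOrlicz

/-! ### Pointwise growth of Orlicz functions. -/

section OrliczFunctions

variable {G : ℝ → ℝ} {pm pp : ℝ}

theorem IsOrlicz.nonneg (hG : IsOrlicz G) (t : ℝ) : 0 ≤ G t := by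
  have h := hG.convex.2 (Set.mem_univ t) (Set.mem_univ (-t)) one_half_pos.le one_half_pos.le
    (add_halves 1)
  have h0 : (1 / 2 : ℝ) • t + (1 / 2 : ℝ) • (-t) = 0 := by simp
  rw [h0, hG.zero, hG.even] at h
  simp only [smul_eq_mul] at h
  linarith

theorem IsOrlicz.pos (hG : IsOrlicz G) {t : ℝ} (ht : 0 < t) : 0 < G t :=
  (hG.nonneg (t / 2)).trans_lt
    (hG.increasing (half_pos ht) ht (half_lt_self ht))

theorem IsOrlicz.map_abs (hG : IsOrlicz G) (t : ℝ) : G |t| = G t := by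
  rcases abs_cases t with ⟨h, -⟩ | ⟨h, -⟩ <;> simp [h, hG.even]

theorem IsOrlicz.mono (hG : IsOrlicz G) {a b : ℝ} (h : |a| ≤ |b|) : G a ≤ G b := by
  rw [← hG.map_abs a, ← hG.map_abs b]
  rcases (abs_nonneg a).eq_or_lt with h0 | h0
  · rw [← h0, hG.zero]; exact hG.nonneg _
  · exact hG.increasing.monotoneOn h0 (h0.trans_le h) h

theorem IsOrlicz.deriv_neg (hG : IsOrlicz G) (t : ℝ) : deriv G (-t) = -deriv G t := by
  have h := deriv_comp_neg G t
  have h2 : (fun x => G (-x)) = G := funext hG.even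
  rw [h2] at h
  linarith

theorem IsOrlicz.deriv_monotone (hG : IsOrlicz G) (hd : Differentiable ℝ G) :
    Monotone (deriv G) := by
  have := hG.convex.monotoneOn_deriv (fun x _ => hd x)
  exact monotoneOn_univ.1 this

theorem HasGrowth.le_mul_deriv (hg : HasGrowth G pm pp) (hG : IsOrlicz G) (t : ℝ) :
    pm * G t ≤ deriv G t * t := by
  have key : ∀ t, 0 < t → pm * G t ≤ deriv G t * t := fun t ht => by
    have := hg.lower t ht
    rw [le_div_iff₀ (hG.pos ht)] at this
    linarith
  rcases lt_trichotomy t 0 with h | h | h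
  · have := key (-t) (by linarith)
    rw [hG.even, hG.deriv_neg] at this
    linarith
  · simp [h, hG.zero]
  · exact key t h

theorem HasGrowth.mul_deriv_le (hg : HasGrowth G pm pp) (hG : IsOrlicz G) (t : ℝ) :
    deriv G t * t ≤ pp * G t := by
  have key : ∀ t, 0 < t → deriv G t * t ≤ pp * G t := fun t ht => by
    have := hg.upper t ht
    rw [div_le_iff₀ (hG.pos ht)] at this
    linarith
  rcases lt_trichotomy t 0 with h | h | h
  · have := key (-t) (by linarith)
    rw [hG.even, hG.deriv_neg] at this
    linarith
  · simp [h, hG.zero]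
  · exact key t h

theorem HasGrowth.pm_le_pp (hg : HasGrowth G pm pp) : pm ≤ pp :=
  (hg.lower 1 one_pos).trans (hg.upper 1 one_pos)

theorem HasGrowth.deriv_nonneg (hg : HasGrowth G pm pp) (hG : IsOrlicz G) {t : ℝ} (ht : 0 ≤ t) :
    0 ≤ deriv G t := by
  have h0 : deriv G 0 = 0 := by
    have := hG.deriv_neg 0
    simp only [neg_zero] at this
    linarith
  exact h0 ▸ hG.deriv_monotone hg.differentiable ht

theorem HasGrowth.abs_deriv (hg : HasGrowth G pm pp) (hG : IsOrlicz G) (t : ℝ) :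
    |deriv G t| = deriv G |t| := by
  rcases abs_cases t with ⟨h, h'⟩ | ⟨h, h'⟩
  · rw [h, abs_of_nonneg (hg.deriv_nonneg hG h')]
  · rw [h, ← abs_neg, ← hG.deriv_neg, abs_of_nonneg (hg.deriv_nonneg hG (by linarith))]

/-- A Young-type inequality for the derivative of an Orlicz function. -/
theorem HasGrowth.abs_deriv_mul_le (hg : HasGrowth G pm pp) (hG : IsOrlicz G) (a b : ℝ) :
    |deriv G a * b| ≤ pp * (G a + G b) := by
  have hp : 0 ≤ pp := hg.pos.le.trans hg.pm_le_pp
  rw [abs_mul, hg.abs_deriv hG]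
  -- As `deriv G` is monotone, both arguments may be replaced by the larger of `|a|` and `|b|`.
  rcases le_total |a| |b| with h | h
  · calc deriv G |a| * |b| ≤ deriv G |b| * |b| := by
          gcongr; exact hG.deriv_monotone hg.differentiable h
      _ ≤ pp * G |b| := hg.mul_deriv_le hG _
      _ ≤ pp * (G a + G b) := by
          rw [hG.map_abs]; gcongr; linarith [hG.nonneg a]
  · calc deriv G |a| * |b| ≤ deriv G |a| * |a| := by
          have := hg.deriv_nonneg hG (abs_nonneg a)
          gcongr
      _ ≤ pp * G |a| := hg.mul_deriv_le hG _
      _ ≤ pp * (G a + G b) := by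
          rw [hG.map_abs]; gcongr; linarith [hG.nonneg b]

/-- The lower growth condition says that `G x * x ^ (-pm)` has nonnegative derivative on `(0, ∞)`;
its values at `1` and `t` are compared. -/
theorem HasGrowth.mul_rpow_le (hg : HasGrowth G pm pp) (hG : IsOrlicz G) {t : ℝ} (ht : 1 ≤ t) :
    G 1 * t ^ pm ≤ G t := by
  have hder : ∀ x, 0 < x → HasDerivAt (fun x => G x * x ^ (-pm))
      (deriv G x * x ^ (-pm) + G x * (-pm * x ^ (-pm - 1))) x := fun x hx =>
    (hg.differentiable x).hasDerivAt.mul (Real.hasDerivAt_rpow_const (Or.inl hx.ne'))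
  have hm : MonotoneOn (fun x => G x * x ^ (-pm)) (Set.Ioi 0) := by
    refine monotoneOn_of_deriv_nonneg (convex_Ioi 0)
      (fun x hx => (hder x hx).continuousAt.continuousWithinAt)
      (fun x hx => ?_) (fun x hx => ?_)
    · rw [interior_Ioi] at hx
      exact (hder x hx).differentiableAt.differentiableWithinAt
    · rw [interior_Ioi] at hx
      have hx : 0 < x := hx
      rw [(hder x hx).deriv]
      have e : x ^ (-pm) = x ^ (-pm - 1) * x := by
        rw [← Real.rpow_add_one hx.ne']; ring_nf
      rw [e]
      have h1 := hg.le_mul_deriv hG x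
      have h2 : 0 ≤ x ^ (-pm - 1) := Real.rpow_nonneg hx.le _
      nlinarith
  have ht0 : (0 : ℝ) < t := by linarith
  have := hm (Set.mem_Ioi.2 one_pos) (Set.mem_Ioi.2 ht0) ht
  simp only [Real.one_rpow, mul_one] at this
  rw [Real.rpow_neg ht0.le, ← div_eq_mul_inv, le_div_iff₀ (Real.rpow_pos_of_pos ht0 _)] at this
  exact this

/-- If `G 1` is not too small, then `G` dominates a power of `|t| / c` where `|t| ≥ c`. -/
theorem HasGrowth.rpow_le (hg : HasGrowth G pm pp) (hG : IsOrlicz G) {c : ℝ} (hc : 1 ≤ c)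
    (h1 : 1 / c ≤ G 1 ^ (1 / pm)) {t : ℝ} (ht : c ≤ |t|) : (|t| / c) ^ pm ≤ G t := by
  have hc0 : 0 < c := by linarith
  have h2 : (1 / c) ^ pm ≤ G 1 := by
    have := Real.rpow_le_rpow (by positivity) h1 hg.pos.le
    rwa [← Real.rpow_mul (hG.nonneg 1), one_div_mul_cancel hg.pos.ne', Real.rpow_one] at this
  calc (|t| / c) ^ pm = (1 / c) ^ pm * |t| ^ pm := by
        rw [← Real.mul_rpow (by positivity) (abs_nonneg t)]; ring_nf
    _ ≤ G 1 * |t| ^ pm := by gcongr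
    _ ≤ G |t| := hg.mul_rpow_le hG (hc.trans ht)
    _ = G t := hG.map_abs t

/-- Truncation at a free level `l`: where `|t| > 2l`, one factor of `(|t|/2)^q ≤ G t` is kept and
the other `q - 1` are bounded below by `l`. The result is linear in `G t`, so it can be integrated,
and its constants do not depend on `G`. -/
theorem HasGrowth.abs_le (hg : HasGrowth G pm pp) (hG : IsOrlicz G)
    (h1 : 1 / 2 ≤ G 1 ^ (1 / pm)) {q : ℝ} (hq1 : 1 ≤ q) (hq : q ≤ pm) {l : ℝ} (hl : 1 ≤ l) (t : ℝ) :
    |t| ≤ 2 * l + 2 * l ^ (1 - q) * G t := by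
  have hl0 : 0 < l := by linarith
  have h0 := hG.nonneg t
  by_cases ht : |t| ≤ 2 * l
  · have : 0 ≤ 2 * l ^ (1 - q) * G t := by positivity
    linarith
  · push Not at ht
    have hlt : l ≤ |t| / 2 := by linarith
    have h3 : (|t| / 2) ^ q ≤ G t :=
      (Real.rpow_le_rpow_of_exponent_le (hl.trans hlt) hq).trans
        (hg.rpow_le hG one_le_two h1 (by linarith))
    have h4 : (|t| / 2) * l ^ (q - 1) ≤ (|t| / 2) ^ q := by
      calc (|t| / 2) * l ^ (q - 1) ≤ (|t| / 2) * (|t| / 2) ^ (q - 1) := by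
            gcongr
        _ = (|t| / 2) ^ q := by
            rw [Real.rpow_sub_one (by linarith)]
            exact mul_div_cancel₀ _ (by linarith)
    have h5 : l ^ (1 - q) * l ^ (q - 1) = 1 := by
      rw [← Real.rpow_add hl0]; simp
    have h6 : 0 < l ^ (1 - q) := Real.rpow_pos_of_pos hl0 _
    have h7 : l ^ (1 - q) * ((|t| / 2) * l ^ (q - 1)) ≤ l ^ (1 - q) * G t := by
      gcongr; exact h4.trans h3
    have h8 : l ^ (1 - q) * ((|t| / 2) * l ^ (q - 1)) = |t| / 2 := by
      linear_combination (|t| / 2) * h5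
    linarith

end OrliczFunctions

variable {N : ℕ} {s : ℝ} {G : ℝ → ℝ} {pm pp : ℝ} {Ω : Set (EuclideanSpace ℝ (Fin N))}
  {f u v w : EuclideanSpace ℝ (Fin N) → ℝ}

/-! ### Integrability and the energy estimate. -/

section Energy

theorem mu_absolutelyContinuous :
    mu N ≪ (volume : Measure (EuclideanSpace ℝ (Fin N))).prod volume :=
  withDensity_absolutelyContinuous _ _

theorem measurable_density : Measurable
    (fun z : EuclideanSpace ℝ (Fin N) × EuclideanSpace ℝ (Fin N) =>
      ENNReal.ofReal (1 / ‖z.1 - z.2‖ ^ N)) := by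
  fun_prop

theorem aemeasurable_holderQuotient (hu : AEMeasurable u volume) :
    AEMeasurable (holderQuotient s u) (mu N) := by
  refine AEMeasurable.mono_ac ?_ mu_absolutelyContinuous
  unfold holderQuotient
  have h1 : AEMeasurable (fun z : EuclideanSpace ℝ (Fin N) × EuclideanSpace ℝ (Fin N) => u z.1)
    (volume.prod volume) := hu.comp_fst
  have h2 : AEMeasurable (fun z : EuclideanSpace ℝ (Fin N) × EuclideanSpace ℝ (Fin N) => u z.2)
    (volume.prod volume) := hu.comp_snd
  have h3 : Measurable (fun z : EuclideanSpace ℝ (Fin N) × EuclideanSpace ℝ (Fin N) =>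
    ‖z.1 - z.2‖ ^ s) := by fun_prop
  exact (h1.sub h2).div h3.aemeasurable

theorem holderQuotient_ae_eq (h : u =ᵐ[volume] v) :
    holderQuotient s u =ᵐ[mu N] holderQuotient s v := by
  refine mu_absolutelyContinuous.ae_eq ?_
  have h1 : u ∘ Prod.fst =ᵐ[(volume : Measure (EuclideanSpace ℝ (Fin N))).prod
      (volume : Measure (EuclideanSpace ℝ (Fin N)))] v ∘ Prod.fst :=
    Measure.quasiMeasurePreserving_fst.ae_eq_comp h
  have h2 : u ∘ Prod.snd =ᵐ[(volume : Measure (EuclideanSpace ℝ (Fin N))).prod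
      (volume : Measure (EuclideanSpace ℝ (Fin N)))] v ∘ Prod.snd :=
    Measure.quasiMeasurePreserving_snd.ae_eq_comp h
  filter_upwards [h1, h2] with z hz1 hz2
  simp only [Function.comp] at hz1 hz2
  simp [holderQuotient, hz1, hz2]

theorem MemW.integrable (hu : MemW s G u) (hG : IsOrlicz G) :
    Integrable (fun x => G (u x)) volume :=
  ⟨(hG.continuous.measurable.comp_aemeasurable hu.aemeasurable).aestronglyMeasurable,
    (hasFiniteIntegral_iff_ofReal (ae_of_all _ fun _ => hG.nonneg _)).2 hu.modular_lt_top⟩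

theorem MemW.integrable_holderQuotient (hu : MemW s G u) (hG : IsOrlicz G) :
    Integrable (fun z => G (holderQuotient s u z)) (mu N) :=
  ⟨(hG.continuous.measurable.comp_aemeasurable
      (aemeasurable_holderQuotient hu.aemeasurable)).aestronglyMeasurable,
    (hasFiniteIntegral_iff_ofReal (ae_of_all _ fun _ => hG.nonneg _)).2 hu.fracModular_lt_top⟩

theorem MemW.integrable_pairing (hu : MemW s G u) (hv : MemW s G v) (hG : IsOrlicz G)
    (hg : HasGrowth G pm pp) :
    Integrable (fun z => deriv G (holderQuotient s u z) * holderQuotient s v z) (mu N) := by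
  refine (((hu.integrable_holderQuotient hG).add (hv.integrable_holderQuotient hG)).const_mul
    pp).mono' ?_ (ae_of_all _ fun z => hg.abs_deriv_mul_le hG _ _)
  exact (((hG.deriv_monotone hg.differentiable).measurable.comp_aemeasurable
    (aemeasurable_holderQuotient hu.aemeasurable)).mul
    (aemeasurable_holderQuotient hv.aemeasurable)).aestronglyMeasurable

theorem abs_holderQuotient (z : EuclideanSpace ℝ (Fin N) × EuclideanSpace ℝ (Fin N)) :
    |holderQuotient s u z| = |u z.1 - u z.2| / ‖z.1 - z.2‖ ^ s := by
  rw [holderQuotient, abs_div, abs_of_nonneg (Real.rpow_nonneg (norm_nonneg _) _)]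

/-- Normal contractions act on `W_0^{s,G}(Ω)`. -/
theorem MemW0.of_contraction (hu : MemW0 s G Ω u) (hG : IsOrlicz G)
    (hv : AEMeasurable v volume) (h1 : ∀ x, |v x| ≤ |u x|)
    (h2 : ∀ x y, |v x - v y| ≤ |u x - u y|) : MemW0 s G Ω v := by
  refine ⟨⟨hv, ?_, ?_⟩, ?_⟩
  · refine lt_of_le_of_lt (lintegral_mono fun x => ?_) hu.1.modular_lt_top
    exact ENNReal.ofReal_le_ofReal (hG.mono (h1 x))
  · refine lt_of_le_of_lt (lintegral_mono fun x => ?_) hu.1.fracModular_lt_top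
    refine ENNReal.ofReal_le_ofReal (hG.mono ?_)
    rw [abs_holderQuotient, abs_holderQuotient]
    exact div_le_div_of_nonneg_right (h2 _ _) (Real.rpow_nonneg (norm_nonneg _) _)
  · filter_upwards [hu.2] with x hx hxΩ
    have := h1 x
    rw [hx hxΩ, abs_zero] at this
    exact abs_nonpos_iff.1 this

theorem IsWeakSolution.pairing_eq (h : IsWeakSolution s G Ω f u) (hv : MemW0 s G Ω v)
    (h0 : ∀ x, 0 ≤ v x) : fracLapPairing s G u v = ∫ x in Ω, f x * v x :=
  le_antisymm (h.2.2 v hv (ae_of_all _ h0)) (h.1.2 v hv (ae_of_all _ h0))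

/-- The energy estimate obtained by testing the equation with the solution itself. -/
theorem IsWeakSolution.energy_le (h : IsWeakSolution s G Ω f u) (hG : IsOrlicz G)
    (hg : HasGrowth G pm pp) (hf : IntegrableOn f Ω) {M : ℝ} (hM : ∀ᵐ x, |u x| ≤ M) :
    pm * ∫ z, G (holderQuotient s u z) ∂(mu N) ≤ 2 * M * ∫ x in Ω, |f x| := by
  have hu := h.1.1
  have hmeas := hu.1.aemeasurable
  -- Only nonnegative test functions are admissible, so `u` is tested through its positive and
  -- negative parts; this costs the factor `2`.
  have hp : MemW0 s G Ω (fun x => max (u x) 0) := by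
    refine hu.of_contraction hG (hmeas.max aemeasurable_const) (fun x => ?_) (fun x y => ?_)
    · rw [abs_of_nonneg (le_max_right _ _)]
      exact max_le (le_abs_self _) (abs_nonneg _)
    · exact abs_max_sub_max_le_abs _ _ _
  have hn : MemW0 s G Ω (fun x => max (-u x) 0) := by
    refine hu.of_contraction hG (hmeas.neg.max aemeasurable_const) (fun x => ?_) (fun x y => ?_)
    · rw [abs_of_nonneg (le_max_right _ _)]
      exact max_le (neg_le_abs _) (abs_nonneg _)
    · refine (abs_max_sub_max_le_abs _ _ _).trans_eq ?_
      rw [← abs_neg]; ring_nf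
  have bound : ∀ v : EuclideanSpace ℝ (Fin N) → ℝ, (∀ x, |v x| ≤ |u x|) →
      |∫ x in Ω, f x * v x| ≤ M * ∫ x in Ω, |f x| := fun v hv => by
    rw [← integral_const_mul]
    rw [← Real.norm_eq_abs]
    refine norm_integral_le_of_norm_le (hf.abs.const_mul M) ?_
    filter_upwards [ae_restrict_of_ae hM] with x hx
    rw [Real.norm_eq_abs, abs_mul, mul_comm]
    gcongr
    exact (hv x).trans hx
  have e1 := h.pairing_eq hp (fun x => le_max_right _ _)
  have e2 := h.pairing_eq hn (fun x => le_max_right _ _)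
  have b1 := bound (fun x => max (u x) 0) fun x => by
    rw [abs_of_nonneg (le_max_right _ _)]
    exact max_le (le_abs_self _) (abs_nonneg _)
  have b2 := bound (fun x => max (-u x) 0) fun x => by
    rw [abs_of_nonneg (le_max_right _ _)]
    exact max_le (neg_le_abs _) (abs_nonneg _)
  have e3 : fracLapPairing s G u (fun x => max (u x) 0) -
      fracLapPairing s G u (fun x => max (-u x) 0) =
      ∫ z, deriv G (holderQuotient s u z) * holderQuotient s u z ∂(mu N) := by
    unfold fracLapPairing
    rw [← integral_sub (hu.1.integrable_pairing hp.1 hG hg) (hu.1.integrable_pairing hn.1 hG hg)]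
    refine integral_congr_ae (ae_of_all _ fun z => ?_)
    have key : ∀ a : ℝ, max a 0 - max (-a) 0 = a := fun a => by
      rcases le_total a 0 with h | h
      · rw [max_eq_right h, max_eq_left (by linarith)]; ring
      · rw [max_eq_left h, max_eq_right (by linarith)]; ring
    simp only [holderQuotient]
    rw [← mul_sub, ← sub_div]
    congr 2
    linear_combination key (u z.1) - key (u z.2)
  have e4 : pm * ∫ z, G (holderQuotient s u z) ∂(mu N) ≤
      ∫ z, deriv G (holderQuotient s u z) * holderQuotient s u z ∂(mu N) := by
    rw [← integral_const_mul]
    exact integral_mono ((hu.1.integrable_holderQuotient hG).const_mul pm)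
      (hu.1.integrable_pairing hu.1 hG hg) fun z => hg.le_mul_deriv hG _
  rw [← e3, e1, e2] at e4
  linarith [abs_le.1 b1, abs_le.1 b2]

end Energy

/-! ### Comparison of ball averages. -/

section Morrey

/-- A kernel `F` controls the increments of `u` at every level `l ≥ 1` and scale `ρ`. -/
def IncrementBound (s q : ℝ) (u : EuclideanSpace ℝ (Fin N) → ℝ)
    (F : EuclideanSpace ℝ (Fin N) × EuclideanSpace ℝ (Fin N) → ℝ) : Prop :=
  ∀ (z : EuclideanSpace ℝ (Fin N) × EuclideanSpace ℝ (Fin N)) (ρ l : ℝ), 0 < ρ → 1 ≤ l →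
    ‖z.1 - z.2‖ ≤ ρ → |u z.1 - u z.2| ≤ ρ ^ s * (2 * l + 2 * l ^ (1 - q) * (ρ ^ N * F z))

/-- The constant in the comparison of ball averages. -/
noncomputable def averageConst (N : ℕ) (s : ℝ) : ℝ :=
  2 * 3 ^ s * (1 + 12 ^ N /
    (volume.real (Metric.ball (0 : EuclideanSpace ℝ (Fin N)) 1)) ^ 2)

theorem volume_real_ball_pos :
    0 < volume.real (Metric.ball (0 : EuclideanSpace ℝ (Fin N)) 1) :=
  ENNReal.toReal_pos (Metric.measure_ball_pos _ _ one_pos).ne' measure_ball_lt_top.ne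

theorem averageConst_pos : 0 < averageConst N s := by
  unfold averageConst
  have := volume_real_ball_pos (N := N)
  positivity

theorem volume_real_closedBall (x : EuclideanSpace ℝ (Fin N)) {a : ℝ} (ha : 0 ≤ a) :
    volume.real (Metric.closedBall x a) =
      a ^ N * volume.real (Metric.ball (0 : EuclideanSpace ℝ (Fin N)) 1) := by
  rw [Measure.addHaar_real_closedBall _ _ ha, finrank_euclideanSpace_fin]

variable {F : EuclideanSpace ℝ (Fin N) × EuclideanSpace ℝ (Fin N) → ℝ}

/-- The increment bound is averaged over the product of the two balls, whose points lie within `3r`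
of each other. With `l = r^(-s/2)` and `q = 2N/s`, one has `l^(1-q) = l * r^N`; together with the
factor `(3r)^N` this cancels the product of volumes, of order `r^(2N)`. Both terms are then of order
`r^s * l = r^(s/2)`. -/
theorem abs_average_sub_average_le (hs : 0 < s) (hu : LocallyIntegrable u volume)
    (hF : Integrable F (volume.prod volume)) (hF0 : ∀ z, 0 ≤ F z)
    (hb : IncrementBound s (2 * N / s) u F)
    {x y : EuclideanSpace ℝ (Fin N)} {a b r : ℝ} (hr0 : 0 < r) (hr1 : r ≤ 1)
    (ha : r / 2 ≤ a) (ha' : a ≤ r) (hb1 : r / 2 ≤ b) (hb' : b ≤ r) (hxy : dist x y ≤ r) :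
    |(⨍ z in Metric.closedBall x a, u z) - ⨍ z in Metric.closedBall y b, u z| ≤
      averageConst N s * (1 + ∫ z, F z ∂(volume.prod volume)) * r ^ (s / 2) := by
  set A := Metric.closedBall x a
  set B := Metric.closedBall y b
  set v0 := volume.real (Metric.ball (0 : EuclideanSpace ℝ (Fin N)) 1) with hv0
  have v0pos : 0 < v0 := volume_real_ball_pos
  set I := ∫ z, F z ∂(volume.prod volume)
  have hI : 0 ≤ I := integral_nonneg hF0
  have hA : volume.real A = a ^ N * v0 := volume_real_closedBall x (by linarith)
  have hB : volume.real B = b ^ N * v0 := volume_real_closedBall y (by linarith)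
  have hA0 : 0 < volume.real A := by rw [hA]; have : 0 < a := by linarith
                                     positivity
  have hB0 : 0 < volume.real B := by rw [hB]; have : 0 < b := by linarith
                                     positivity
  have hAB : (r / 2) ^ (2 * N) * v0 ^ 2 ≤ volume.real A * volume.real B := by
    rw [hA, hB, two_mul, pow_add]
    have h1 : (r / 2) ^ N ≤ a ^ N := by gcongr
    have h2 : (r / 2) ^ N ≤ b ^ N := by gcongr
    have h0 : 0 ≤ a := by linarith
    have h3 : (r / 2) ^ N * (r / 2) ^ N ≤ a ^ N * b ^ N := by gcongr
    calc _ ≤ a ^ N * b ^ N * v0 ^ 2 := by gcongr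
      _ = _ := by ring
  set l : ℝ := r ^ (-(s / 2)) with hl
  have hl1 : 1 ≤ l := Real.one_le_rpow_of_pos_of_le_one_of_nonpos hr0 hr1 (by linarith)
  have hl0 : 0 < l := by linarith
  have hlq : l ^ (1 - 2 * N / s) = r ^ (-(s / 2)) * r ^ N := by
    rw [hl, ← Real.rpow_mul hr0.le, ← Real.rpow_natCast r N, ← Real.rpow_add hr0]
    congr 1
    field_simp
    ring
  have : IsFiniteMeasure (volume.restrict A) :=
    isFiniteMeasure_restrict.2 measure_closedBall_lt_top.ne
  have : IsFiniteMeasure (volume.restrict B) :=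
    isFiniteMeasure_restrict.2 measure_closedBall_lt_top.ne
  have huA : Integrable u (volume.restrict A) :=
    hu.integrableOn_isCompact (isCompact_closedBall x a)
  have huB : Integrable u (volume.restrict B) :=
    hu.integrableOn_isCompact (isCompact_closedBall y b)
  have hν : (volume.restrict A).prod (volume.restrict B) =
      ((volume : Measure (EuclideanSpace ℝ (Fin N))).prod volume).restrict (A ×ˢ B) :=
    Measure.prod_restrict A B
  set ν := (volume.restrict A).prod (volume.restrict B) with hνdef
  have hFν : Integrable F ν := by rw [hν]; exact hF.restrict
  have hIν : ∫ z, F z ∂ν ≤ I := by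
    rw [hν]; exact setIntegral_le_integral hF (ae_of_all _ hF0)
  have hνreal : ν.real Set.univ = volume.real A * volume.real B := by
    rw [hνdef, ← Set.univ_prod_univ, measureReal_prod_prod]
    simp
  have e1 : ∫ z, (u z.1 - u z.2) ∂ν =
      volume.real B * (∫ z in A, u z) - volume.real A * ∫ z in B, u z := by
    rw [integral_sub (huA.comp_fst _) (huB.comp_snd _), integral_fun_fst, integral_fun_snd]
    simp
  have e2 : |∫ z, (u z.1 - u z.2) ∂ν| ≤
      ∫ z, (3 * r) ^ s * (2 * l + 2 * l ^ (1 - 2 * N / s) * ((3 * r) ^ N * F z)) ∂ν := by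
    rw [← Real.norm_eq_abs]
    refine norm_integral_le_of_norm_le ?_ ?_
    · exact ((integrable_const _).add ((hFν.const_mul _).const_mul _)).const_mul _
    · have hmem : ∀ᵐ z ∂ν, z ∈ A ×ˢ B := by
        rw [hν]
        exact ae_restrict_mem (Metric.isClosed_closedBall.measurableSet.prod
          Metric.isClosed_closedBall.measurableSet)
      filter_upwards [hmem] with z hz
      refine hb z _ _ (by linarith) hl1 ?_
      rw [← dist_eq_norm]
      have h1 : dist z.1 x ≤ a := hz.1
      have h2 : dist z.2 y ≤ b := hz.2
      have h3 := dist_triangle4 z.1 x y z.2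
      rw [dist_comm y] at h3
      linarith
  have e3 : ∫ z, (3 * r) ^ s * (2 * l + 2 * l ^ (1 - 2 * N / s) * ((3 * r) ^ N * F z)) ∂ν =
      (3 * r) ^ s * (2 * l * (volume.real A * volume.real B) +
        2 * l ^ (1 - 2 * N / s) * ((3 * r) ^ N * ∫ z, F z ∂ν)) := by
    rw [integral_const_mul, integral_add (integrable_const _) ((hFν.const_mul _).const_mul _),
      integral_const, hνreal, smul_eq_mul, integral_const_mul, integral_const_mul]
    ring
  rw [e1, e3] at e2
  have e4 : (⨍ z in A, u z) - ⨍ z in B, u z =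
      (volume.real B * (∫ z in A, u z) - volume.real A * ∫ z in B, u z) /
        (volume.real A * volume.real B) := by
    rw [setAverage_eq, setAverage_eq, smul_eq_mul, smul_eq_mul]
    field_simp
  rw [e4, abs_div, abs_of_pos (mul_pos hA0 hB0), div_le_iff₀ (mul_pos hA0 hB0)]
  refine e2.trans ?_
  have e5 : 2 * l ^ (1 - 2 * N / s) * ((3 * r) ^ N * ∫ z, F z ∂ν) ≤
      2 * l ^ (1 - 2 * N / s) * ((3 * r) ^ N * I) := by gcongr
  -- The `12` arises from `(3r)^N * r^N = 12^N * (r/2)^(2N)`.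
  have e6 : 2 * l ^ (1 - 2 * N / s) * ((3 * r) ^ N * I) =
      2 * l * (12 ^ N / v0 ^ 2) * I * ((r / 2) ^ (2 * N) * v0 ^ 2) := by
    rw [hlq, ← hl, mul_pow, div_pow, pow_mul 2 2 N, pow_mul r 2 N,
      show (12 : ℝ) = 3 * 2 ^ 2 by norm_num, mul_pow, ← pow_mul r, mul_comm 2 N, pow_mul]
    field_simp
  have e7 : 2 * l * (12 ^ N / v0 ^ 2) * I * ((r / 2) ^ (2 * N) * v0 ^ 2) ≤
      2 * l * (12 ^ N / v0 ^ 2) * I * (volume.real A * volume.real B) := by gcongr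
  have e8 : (3 * r) ^ s * l = 3 ^ s * r ^ (s / 2) := by
    rw [Real.mul_rpow (by norm_num) hr0.le, hl, mul_assoc, ← Real.rpow_add hr0]
    ring_nf
  have hr2 : 0 ≤ 3 ^ s * r ^ (s / 2) := by positivity
  calc _ ≤ (3 * r) ^ s * (2 * l * (volume.real A * volume.real B) +
          2 * l * (12 ^ N / v0 ^ 2) * I * (volume.real A * volume.real B)) := by
        refine mul_le_mul_of_nonneg_left ?_ (by positivity)
        linarith
    _ = 2 * (3 ^ s * r ^ (s / 2)) * (1 + 12 ^ N / v0 ^ 2 * I) *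
          (volume.real A * volume.real B) := by
        rw [← e8]; ring
    _ ≤ 2 * (3 ^ s * r ^ (s / 2)) * ((1 + 12 ^ N / v0 ^ 2) * (1 + I)) *
          (volume.real A * volume.real B) := by
        have : 0 ≤ 12 ^ N / v0 ^ 2 := by positivity
        gcongr
        nlinarith
    _ = _ := by
        unfold averageConst
        rw [← hv0]; ring

end Morrey

/-! ### Hölder representatives of finite-energy functions. -/

section Representative

variable {F : EuclideanSpace ℝ (Fin N) × EuclideanSpace ℝ (Fin N) → ℝ}

/-- The constant in the Morrey-type estimate. -/
noncomputable def holderConst (N : ℕ) (s : ℝ) : ℝ :=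
  averageConst N s * (1 + 2 / (1 - (1 / 2) ^ (s / 2))) * 2 ^ (s / 2)

theorem half_rpow_lt_one (hs : 0 < s) : (1 / 2 : ℝ) ^ (s / 2) < 1 :=
  Real.rpow_lt_one (by norm_num) (by norm_num) (by linarith)

theorem holderConst_pos (hs : 0 < s) : 0 < holderConst N s := by
  unfold holderConst
  have h1 := averageConst_pos (N := N) (s := s)
  have h2 : 0 < 1 - (1 / 2 : ℝ) ^ (s / 2) := sub_pos.2 (half_rpow_lt_one hs)
  positivity

/-- Averages over balls of radius `2^(-k)` form a geometrically Cauchy sequence at every point, and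
by Lebesgue differentiation their limit is `u` almost everywhere. Two points are compared through
their averages at the dyadic scale of their distance. -/
theorem exists_holder_representative (hs : 0 < s) (hu : LocallyIntegrable u volume)
    (hF : Integrable F (volume.prod volume)) (hF0 : ∀ z, 0 ≤ F z)
    (hb : IncrementBound s (2 * N / s) u F) :
    ∃ w : EuclideanSpace ℝ (Fin N) → ℝ, w =ᵐ[volume] u ∧ ∀ x y, ‖x - y‖ ≤ 1 →
      |w x - w y| ≤
        holderConst N s * (1 + ∫ z, F z ∂(volume.prod volume)) * ‖x - y‖ ^ (s / 2) := by
  set I := ∫ z, F z ∂(volume.prod volume)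
  have hI : 0 ≤ I := integral_nonneg hF0
  set K := averageConst N s * (1 + I) with hK
  have hK0 : 0 < K := mul_pos averageConst_pos (by linarith)
  set θ : ℝ := (1 / 2) ^ (s / 2) with hθ
  have hθ1 : θ < 1 := half_rpow_lt_one hs
  have hθpow : ∀ k : ℕ, ((1 / 2 : ℝ) ^ k) ^ (s / 2) = θ ^ k := fun k =>
    (Real.rpow_pow_comm (by norm_num) _ _).symm
  let a : ℕ → EuclideanSpace ℝ (Fin N) → ℝ := fun k x =>
    ⨍ z in Metric.closedBall x ((1 / 2) ^ k), u z
  have hk0 : ∀ k : ℕ, (0 : ℝ) < (1 / 2) ^ k := fun k => by positivity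
  have hk1 : ∀ k : ℕ, (1 / 2 : ℝ) ^ k ≤ 1 := fun k => pow_le_one₀ (by norm_num) (by norm_num)
  have step : ∀ x k, dist (a k x) (a (k + 1) x) ≤ K * θ ^ k := fun x k => by
    rw [← hθpow, Real.dist_eq]
    have h2 : (1 / 2 : ℝ) ^ (k + 1) = (1 / 2) ^ k / 2 := by rw [pow_succ]; ring
    have := hk0 k
    exact abs_average_sub_average_le hs hu hF hF0 hb (hk0 k) (hk1 k) (by linarith) le_rfl
      h2.ge (by linarith) (by rw [dist_self]; linarith)
  have lim : ∀ x, ∃ l, Tendsto (fun k => a k x) atTop (𝓝 l) := fun x =>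
    cauchySeq_tendsto_of_complete (cauchySeq_of_le_geometric θ K hθ1 (step x))
  choose w hw using lim
  refine ⟨w, ?_, fun x y hxy => ?_⟩
  · filter_upwards [IsUnifLocDoublingMeasure.ae_tendsto_average volume hu 1] with x hx
    refine tendsto_nhds_unique (hw x) (hx (fun _ : ℕ => x) (fun k : ℕ => (1 / 2 : ℝ) ^ k) ?_ ?_)
    · exact tendsto_nhdsWithin_iff.2
        ⟨tendsto_pow_atTop_nhds_zero_of_lt_one (by norm_num) (by norm_num),
          Eventually.of_forall hk0⟩
    · refine Eventually.of_forall fun k => Metric.mem_closedBall_self ?_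
      have := hk0 k
      linarith
  · rcases eq_or_ne x y with rfl | hne
    · rw [sub_self, abs_zero]
      have := holderConst_pos (N := N) hs
      positivity
    have hd : 0 < ‖x - y‖ := norm_pos_iff.2 (sub_ne_zero.2 hne)
    obtain ⟨k, hlt, hle⟩ := exists_nat_pow_near_of_lt_one hd hxy
      (by norm_num : (0 : ℝ) < 1 / 2) (by norm_num)
    have d1 := dist_le_of_le_geometric_of_tendsto θ K hθ1 (step x) (hw x) k
    have d2 := dist_le_of_le_geometric_of_tendsto θ K hθ1 (step y) (hw y) k
    have d3 : dist (a k x) (a k y) ≤ K * θ ^ k := by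
      rw [← hθpow, Real.dist_eq]
      have := hk0 k
      exact abs_average_sub_average_le hs hu hF hF0 hb (hk0 k) (hk1 k) (by linarith) le_rfl
        (by linarith) le_rfl (by rwa [dist_eq_norm])
    have d4 : θ ^ k ≤ 2 ^ (s / 2) * ‖x - y‖ ^ (s / 2) := by
      rw [← hθpow, ← Real.mul_rpow (by norm_num) hd.le]
      refine Real.rpow_le_rpow (hk0 k).le ?_ (by linarith)
      rw [pow_succ] at hlt
      linarith
    have h1θ : 0 < 1 - θ := by linarith
    rw [← Real.dist_eq]
    calc dist (w x) (w y) ≤ dist (w x) (a k x) + dist (a k x) (a k y) + dist (a k y) (w y) :=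
          dist_triangle4 _ _ _ _
      _ ≤ K * θ ^ k / (1 - θ) + K * θ ^ k + K * θ ^ k / (1 - θ) := by
          rw [dist_comm (w x)]; gcongr
      _ = K * (1 + 2 / (1 - θ)) * θ ^ k := by field_simp; ring
      _ ≤ K * (1 + 2 / (1 - θ)) * (2 ^ (s / 2) * ‖x - y‖ ^ (s / 2)) := by gcongr
      _ = _ := by unfold holderConst; rw [hK, ← hθ]; ring

/-- The density of the fractional energy with respect to Lebesgue measure. -/
noncomputable def energyDensity (s : ℝ) (G : ℝ → ℝ) (u : EuclideanSpace ℝ (Fin N) → ℝ)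
    (z : EuclideanSpace ℝ (Fin N) × EuclideanSpace ℝ (Fin N)) : ℝ :=
  1 / ‖z.1 - z.2‖ ^ N * G (holderQuotient s u z)

theorem energyDensity_nonneg (hG : IsOrlicz G)
    (z : EuclideanSpace ℝ (Fin N) × EuclideanSpace ℝ (Fin N)) : 0 ≤ energyDensity s G u z :=
  mul_nonneg (by positivity) (hG.nonneg _)

theorem toReal_density (z : EuclideanSpace ℝ (Fin N) × EuclideanSpace ℝ (Fin N)) :
    (ENNReal.ofReal (1 / ‖z.1 - z.2‖ ^ N)).toReal = 1 / ‖z.1 - z.2‖ ^ N :=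
  ENNReal.toReal_ofReal (by positivity)

theorem MemW.integrable_energyDensity (hu : MemW s G u) (hG : IsOrlicz G) :
    Integrable (energyDensity s G u) (volume.prod volume) := by
  have := hu.integrable_holderQuotient hG
  rw [mu, integrable_withDensity_iff_integrable_smul' measurable_density
    (ae_of_all _ fun _ => ENNReal.ofReal_lt_top)] at this
  simp only [toReal_density, smul_eq_mul] at this
  exact this

theorem integral_energyDensity :
    ∫ z, energyDensity s G u z ∂(volume.prod volume) =
      ∫ z, G (holderQuotient s u z) ∂(mu N) := by
  rw [mu, integral_withDensity_eq_integral_toReal_smul measurable_density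
    (ae_of_all _ fun _ => ENNReal.ofReal_lt_top)]
  simp only [toReal_density, smul_eq_mul, energyDensity]

/-- For `|x - y| ≤ ρ` the weight `1 / |x - y|^N` is at least `ρ^(-N)`, so `ρ^N` times the energy
density dominates `G (D^s u)`; then `HasGrowth.abs_le` applies. -/
theorem HasGrowth.incrementBound (hg : HasGrowth G pm pp) (hG : IsOrlicz G)
    (h1 : 1 / 2 ≤ G 1 ^ (1 / pm)) (hN : 1 ≤ N) (hs0 : 0 < s) (hs1 : s < 1)
    (hq : 2 * N / s ≤ pm) (u : EuclideanSpace ℝ (Fin N) → ℝ) :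
    IncrementBound s (2 * N / s) u (energyDensity s G u) := by
  intro z ρ l hρ hl hz
  have hl0 : 0 < l := by linarith
  have hE := energyDensity_nonneg (s := s) (u := u) hG z
  have hq1 : (1 : ℝ) ≤ 2 * N / s := by
    rw [le_div_iff₀ hs0]
    have : (1 : ℝ) ≤ N := by exact_mod_cast hN
    linarith
  rcases eq_or_ne z.1 z.2 with h | h
  · rw [h, sub_self, abs_zero]
    positivity
  · have hd : 0 < ‖z.1 - z.2‖ := norm_pos_iff.2 (sub_ne_zero.2 h)
    have hds : 0 < ‖z.1 - z.2‖ ^ s := Real.rpow_pos_of_pos hd s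
    have e : |u z.1 - u z.2| = ‖z.1 - z.2‖ ^ s * |holderQuotient s u z| := by
      rw [abs_holderQuotient, mul_div_cancel₀ _ hds.ne']
    have hGF : G (holderQuotient s u z) ≤ ρ ^ N * energyDensity s G u z := by
      unfold energyDensity
      rw [← mul_assoc, mul_one_div]
      refine le_mul_of_one_le_left (hG.nonneg _) ?_
      rw [one_le_div (by positivity)]
      gcongr
    rw [e]
    have h2 := hg.abs_le hG h1 hq1 hq hl (holderQuotient s u z)
    calc _ ≤ ρ ^ s * |holderQuotient s u z| := by gcongr
      _ ≤ ρ ^ s * (2 * l + 2 * l ^ (1 - 2 * N / s) * G (holderQuotient s u z)) := by gcongr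
      _ ≤ _ := by gcongr

theorem MemW.locallyIntegrable (hu : MemW s G u) (hg : HasGrowth G pm pp) (hG : IsOrlicz G)
    (h1 : 1 / 2 ≤ G 1 ^ (1 / pm)) (hp : 1 ≤ pm) : LocallyIntegrable u volume := by
  have h2 : LocallyIntegrable (fun x => 2 + 2 * G (u x)) volume :=
    (locallyIntegrable_const 2).add ((hu.integrable hG).const_mul 2).locallyIntegrable
  refine h2.mono hu.aemeasurable.aestronglyMeasurable (ae_of_all _ fun x => ?_)
  -- With `q = l = 1` this reads `|u| ≤ 2 + 2 G(u)`.
  have := hg.abs_le hG h1 le_rfl hp le_rfl (u x)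
  rw [Real.norm_eq_abs]
  refine (this.trans ?_).trans (le_abs_self _)
  simp

end Representative

/-! ### Exterior of the domain and chaining. -/

section Domain

/-- Moving a boundary point in the direction `-e` keeps its projection and puts it strictly below
the graph, hence in the interior of the complement. This lets a continuous function vanishing a.e.
outside `Ω` vanish everywhere there. -/
theorem compl_subset_closure_interior_compl (hΩ : IsOpen Ω) (hL : HasLipschitzBoundary Ω) :
    Ωᶜ ⊆ closure (interior Ωᶜ) := by
  intro x hx
  by_cases hfr : x ∈ frontier Ω
  · obtain ⟨e, γ, L, ρ, he, hγ, hρ, h⟩ := hL x hfr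
    have key : ∀ t : ℝ, 0 < t → t < ρ → x - t • e ∈ interior Ωᶜ := fun t ht htρ => by
      have hmem : x - t • e ∈ Metric.ball x ρ := by
        rw [mem_ball_iff_norm, sub_sub_cancel_left, norm_neg, norm_smul, he, mul_one,
          Real.norm_eq_abs, abs_of_pos ht]
        exact htρ
      have hx' : inner ℝ x e ≤ γ (x - inner ℝ x e • e) := by
        by_contra hcon
        exact hx ((h x (Metric.mem_ball_self hρ)).2 (not_le.1 hcon))
      have hee : inner ℝ e e = (1 : ℝ) := by rw [real_inner_self_eq_norm_sq, he]; norm_num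
      have hin : inner ℝ (x - t • e) e = inner ℝ x e - t := by
        rw [inner_sub_left, real_inner_smul_left, hee, mul_one]
      have hproj : x - t • e - inner ℝ (x - t • e) e • e = x - inner ℝ x e • e := by
        rw [hin, sub_smul]; abel
      have hlt : inner ℝ (x - t • e) e < γ (x - t • e - inner ℝ (x - t • e) e • e) := by
        rw [hproj, hin]; linarith
      have hopen : IsOpen (Metric.ball x ρ ∩ {y | inner ℝ y e < γ (y - inner ℝ y e • e)}) := by
        refine Metric.isOpen_ball.inter (isOpen_lt (by fun_prop) ?_)
        exact hγ.continuous.comp (by fun_prop)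
      refine mem_interior.2 ⟨_, fun y hy hyΩ => ?_, hopen, hmem, hlt⟩
      exact absurd ((h y hy.1).1 hyΩ) (not_lt.2 (le_of_lt hy.2))
    have hlim : Tendsto (fun t : ℝ => x - t • e) (𝓝[>] 0) (𝓝 x) := by
      have : Tendsto (fun t : ℝ => x - t • e) (𝓝 0) (𝓝 (x - (0 : ℝ) • e)) :=
        Continuous.tendsto (by fun_prop) 0
      rw [zero_smul, sub_zero] at this
      exact this.mono_left nhdsWithin_le_nhds
    refine mem_closure_of_tendsto hlim ?_
    filter_upwards [Ioo_mem_nhdsGT hρ] with t ht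
    exact key t ht.1 ht.2
  · refine subset_closure ?_
    rw [interior_compl]
    rw [hΩ.frontier_eq] at hfr
    exact fun hcl => hfr ⟨hcl, hx⟩

theorem eq_zero_of_ae_eq_zero (hΩ : IsOpen Ω) (hL : HasLipschitzBoundary Ω) (hw : Continuous w)
    (h0 : ∀ᵐ x ∂volume, x ∉ Ω → w x = 0) {x : EuclideanSpace ℝ (Fin N)} (hx : x ∉ Ω) :
    w x = 0 := by
  have hcl : IsClosed {x | w x = 0} := isClosed_eq hw continuous_const
  have hint : interior Ωᶜ ⊆ {x | w x = 0} := by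
    have hopen : IsOpen (interior Ωᶜ ∩ {x | w x = 0}ᶜ) := isOpen_interior.inter hcl.isOpen_compl
    have hnull : volume (interior Ωᶜ ∩ {x | w x = 0}ᶜ) = 0 := by
      refine measure_mono_null (fun y hy => ?_) (ae_iff.1 h0)
      exact fun hcon => hy.2 (hcon (interior_subset hy.1))
    have := (hopen.measure_eq_zero_iff volume).1 hnull
    exact fun y hy => by_contra fun hcon => (this ▸ ⟨hy, hcon⟩ : y ∈ (∅ : Set _))
  exact closure_minimal hint hcl (compl_subset_closure_interior_compl hΩ hL hx)

theorem exists_nat_forall_exists_notMem (hN : 1 ≤ N) (hΩ : Bornology.IsBounded Ω) :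
    ∃ m : ℕ, ∀ x, ∃ y ∉ Ω, ‖x - y‖ ≤ m := by
  obtain ⟨R, hR⟩ := hΩ.subset_closedBall 0
  let y : EuclideanSpace ℝ (Fin N) := EuclideanSpace.single ⟨0, hN⟩ (|R| + 1)
  have hy : ‖y‖ = |R| + 1 := by
    simp only [y, PiLp.norm_single, Real.norm_eq_abs]
    exact abs_of_pos (by positivity)
  have hR' := le_abs_self R
  have hyΩ : y ∉ Ω := fun h => by
    have := mem_closedBall_zero_iff.1 (hR h)
    linarith
  obtain ⟨m, hm⟩ := exists_nat_ge (2 * |R| + 1)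
  refine ⟨m, fun x => ?_⟩
  by_cases hx : x ∈ Ω
  · refine ⟨y, hyΩ, (norm_sub_le _ _).trans ?_⟩
    have := mem_closedBall_zero_iff.1 (hR hx)
    linarith
  · exact ⟨x, hx, by simp⟩

/-- The segment from `x` to `y` is cut into `m` pieces of length at most `1`. -/
theorem abs_sub_le_of_unit_scale {H : ℝ} (h : ∀ x y, ‖x - y‖ ≤ 1 → |w x - w y| ≤ H) (m : ℕ) :
    ∀ x y, ‖x - y‖ ≤ m → |w x - w y| ≤ m * H := by
  induction m with
  | zero =>
    intro x y hxy
    have : x = y := by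
      rw [← sub_eq_zero, ← norm_le_zero_iff]
      simpa using hxy
    simp [this]
  | succ m ih =>
    intro x y hxy
    push_cast at hxy
    have hm : (0 : ℝ) < m + 1 := by positivity
    set z := y + ((m : ℝ) / (m + 1)) • (x - y)
    have h1 : ‖z - y‖ ≤ m := by
      rw [add_sub_cancel_left, norm_smul, Real.norm_eq_abs, abs_of_nonneg (by positivity),
        div_mul_eq_mul_div, div_le_iff₀ hm]
      gcongr
    have h2 : ‖x - z‖ ≤ 1 := by
      have e : x - z = ((1 : ℝ) / (m + 1)) • (x - y) := by
        have : (1 : ℝ) / (m + 1) = 1 - m / (m + 1) := by field_simp; ring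
        rw [this, sub_smul, one_smul]
        simp only [z]
        abel
      rw [e, norm_smul, Real.norm_eq_abs, abs_of_nonneg (by positivity), div_mul_eq_mul_div,
        div_le_iff₀ hm]
      linarith
    have h3 := abs_sub_le (w x) (w z) (w y)
    have h4 := h x z h2
    have h5 := ih z y h1
    push_cast
    linarith

end Domain

/-! ### Morrey embedding and global bounds. -/

section UniformEstimates

theorem continuous_of_unit_scale {H α : ℝ} (hα : 0 < α)
    (h : ∀ x y, ‖x - y‖ ≤ 1 → |w x - w y| ≤ H * ‖x - y‖ ^ α) : Continuous w := by
  rw [continuous_iff_continuousAt]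
  intro y
  have hlim : Tendsto (fun x => H * ‖x - y‖ ^ α) (𝓝 y) (𝓝 0) := by
    have hc : Continuous fun x : EuclideanSpace ℝ (Fin N) => H * ‖x - y‖ ^ α := by
      fun_prop (disch := exact hα.le)
    have := hc.tendsto y
    simpa [Real.zero_rpow hα.ne'] using this
  refine tendsto_iff_dist_tendsto_zero.2 (squeeze_zero' (Eventually.of_forall fun _ => dist_nonneg)
    ?_ hlim)
  filter_upwards [Metric.closedBall_mem_nhds y one_pos] with x hx
  rw [Real.dist_eq]
  exact h x y (by rwa [mem_closedBall_iff_norm] at hx)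

/-- Morrey-type embedding: a continuous representative with quantitative Hölder control. -/
theorem MemW0.exists_continuous_representative (hu : MemW0 s G Ω u) (hg : HasGrowth G pm pp)
    (hG : IsOrlicz G) (h1 : 1 / 2 ≤ G 1 ^ (1 / pm)) (hN : 1 ≤ N) (hs0 : 0 < s) (hs1 : s < 1)
    (hq : 2 * N / s ≤ pm) (hΩ : IsOpen Ω) (hL : HasLipschitzBoundary Ω) :
    ∃ w : EuclideanSpace ℝ (Fin N) → ℝ, Continuous w ∧ w =ᵐ[volume] u ∧ (∀ x ∉ Ω, w x = 0) ∧
      ∀ x y, ‖x - y‖ ≤ 1 → |w x - w y| ≤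
        holderConst N s * (1 + ∫ z, G (holderQuotient s u z) ∂(mu N)) * ‖x - y‖ ^ (s / 2) := by
  have hp1 : (1 : ℝ) ≤ pm := by
    refine le_trans ?_ hq
    rw [le_div_iff₀ hs0]
    have : (1 : ℝ) ≤ N := by exact_mod_cast hN
    linarith
  obtain ⟨w, hwu, hw⟩ := exists_holder_representative hs0 (hu.1.locallyIntegrable hg hG h1 hp1)
    (hu.1.integrable_energyDensity hG) (energyDensity_nonneg hG)
    (hg.incrementBound hG h1 hN hs0 hs1 hq u)
  rw [integral_energyDensity] at hw
  have hc : Continuous w := continuous_of_unit_scale (half_pos hs0) hw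
  refine ⟨w, hc, hwu, fun x hx => eq_zero_of_ae_eq_zero hΩ hL hc ?_ hx, hw⟩
  filter_upwards [hwu, hu.2] with y hy1 hy2 hy
  rw [hy1, hy2 hy]

theorem abs_le_of_unit_scale {H α : ℝ} {m : ℕ} (hm : ∀ x, ∃ y ∉ Ω, ‖x - y‖ ≤ m) (hH : 0 ≤ H)
    (hα : 0 ≤ α) (h0 : ∀ x ∉ Ω, w x = 0)
    (h : ∀ x y, ‖x - y‖ ≤ 1 → |w x - w y| ≤ H * ‖x - y‖ ^ α) (x : EuclideanSpace ℝ (Fin N)) :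
    |w x| ≤ m * H := by
  obtain ⟨y, hy, hxy⟩ := hm x
  have := abs_sub_le_of_unit_scale (w := w) (H := H) (fun x y hxy => (h x y hxy).trans
    (mul_le_of_le_one_right hH (Real.rpow_le_one (norm_nonneg _) hxy hα))) m x y hxy
  rwa [h0 y hy, sub_zero] at this

theorem abs_sub_le_of_bound_of_unit_scale {H C α : ℝ} (hH : 0 ≤ H) (hα : 0 ≤ α)
    (hC : ∀ x, |w x| ≤ C)
    (h : ∀ x y, ‖x - y‖ ≤ 1 → |w x - w y| ≤ H * ‖x - y‖ ^ α) (x y : EuclideanSpace ℝ (Fin N)) :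
    |w x - w y| ≤ (H + 2 * C) * ‖x - y‖ ^ α := by
  have hC0 : 0 ≤ C := (abs_nonneg _).trans (hC x)
  have hp : 0 ≤ ‖x - y‖ ^ α := Real.rpow_nonneg (norm_nonneg _) _
  rcases le_total ‖x - y‖ 1 with hle | hle
  · refine (h x y hle).trans ?_
    gcongr
    linarith
  · have h1 : 1 ≤ ‖x - y‖ ^ α := Real.one_le_rpow hle hα
    have h2 := abs_sub (w x) (w y)
    have h3 := hC x
    have h4 := hC y
    nlinarith

end UniformEstimates

/-! ### Uniform convergence of a subsequence. -/

section Compactness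

/-- Arzelà–Ascoli for equi-Hölder functions supported in a common bounded set. -/
theorem exists_subseq_tendstoUniformly {W : ℕ → EuclideanSpace ℝ (Fin N) → ℝ} {C H α : ℝ}
    (hΩ : Bornology.IsBounded Ω) (hα : 0 < α) (hC : ∀ k x, |W k x| ≤ C)
    (h0 : ∀ k, ∀ x ∉ Ω, W k x = 0) (hH : ∀ k x y, |W k x - W k y| ≤ H * ‖x - y‖ ^ α) :
    ∃ (ψ : ℕ → ℕ) (g : EuclideanSpace ℝ (Fin N) → ℝ), StrictMono ψ ∧
      TendstoUniformly (fun k => W (ψ k)) g atTop := by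
  classical
  obtain ⟨R, hR⟩ := hΩ.subset_closedBall 0
  set K : Set (EuclideanSpace ℝ (Fin N)) := Metric.closedBall 0 R
  have : CompactSpace K := isCompact_iff_compactSpace.1 (isCompact_closedBall 0 R)
  have hcont : ∀ k, Continuous (W k) := fun k =>
    continuous_of_unit_scale hα (fun x y _ => hH k x y)
  let B : ℕ → BoundedContinuousFunction K ℝ := fun k =>
    BoundedContinuousFunction.mkOfCompact ⟨fun x => W k x, (hcont k).comp continuous_subtype_val⟩
  have hB : ∀ k x, B k x = W k x := fun _ _ => rfl
  have hequi : Equicontinuous (fun g : Set.range B => ⇑(g : BoundedContinuousFunction K ℝ)) := by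
    refine Metric.equicontinuous_of_continuity_modulus (fun t => H * t ^ α) ?_ _ ?_
    · have hc : Continuous fun t : ℝ => H * t ^ α := by
        fun_prop (disch := exact hα.le)
      have := hc.tendsto 0
      simpa [Real.zero_rpow hα.ne'] using this
    · rintro x y ⟨_, k, rfl⟩
      rw [Real.dist_eq, Subtype.dist_eq, dist_eq_norm]
      exact hH k x y
  have hcomp : IsCompact (closure (Set.range B)) := by
    refine BoundedContinuousFunction.arzela_ascoli (Set.Icc (-C) C) isCompact_Icc _ ?_ hequi
    rintro _ x ⟨k, rfl⟩
    exact abs_le.1 (hC k x)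
  obtain ⟨g, -, ψ, hψ, hg⟩ := hcomp.tendsto_subseq
    (fun k => subset_closure (Set.mem_range_self k))
  -- Extension by zero preserves uniform convergence, as every `W k` vanishes off the ball.
  refine ⟨ψ, fun x => if hx : x ∈ K then g ⟨x, hx⟩ else 0, hψ, ?_⟩
  rw [BoundedContinuousFunction.tendsto_iff_tendstoUniformly, Metric.tendstoUniformly_iff] at hg
  rw [Metric.tendstoUniformly_iff]
  intro ε hε
  filter_upwards [hg ε hε] with k hk x
  by_cases hx : x ∈ K
  · rw [dif_pos hx]
    exact hk ⟨x, hx⟩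
  · rw [dif_neg hx, h0 _ x (fun h => hx (hR h)), dist_self]
    exact hε

end Compactness

/-! ### Hölder quotients of the limit. -/

section Seminorm

theorem continuousOn_holderQuotient (hu : Continuous u) :
    ContinuousOn (holderQuotient s u) {z | z.1 ≠ z.2} := by
  unfold holderQuotient
  refine ContinuousOn.div (by fun_prop) ?_ ?_
  · refine ContinuousOn.rpow_const (by fun_prop) fun z hz => Or.inl ?_
    exact norm_ne_zero_iff.2 (sub_ne_zero.2 hz)
  · intro z hz
    exact (Real.rpow_pos_of_pos (norm_pos_iff.2 (sub_ne_zero.2 hz)) _).ne'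

theorem enorm_holderQuotient (x y : EuclideanSpace ℝ (Fin N)) :
    ‖holderQuotient s u (x, y)‖ₑ = ENNReal.ofReal (|u x - u y| / ‖x - y‖ ^ s) := by
  rw [Real.enorm_eq_ofReal_abs, abs_holderQuotient]

theorem eq_empty_of_mu_eq_zero
    {U : Set (EuclideanSpace ℝ (Fin N) × EuclideanSpace ℝ (Fin N))} (hU : IsOpen U)
    (hne : ∀ z ∈ U, z.1 ≠ z.2) (h : mu N U = 0) : U = ∅ := by
  rw [mu, withDensity_apply_eq_zero measurable_density] at h
  refine (hU.measure_eq_zero_iff (volume.prod volume)).1 (measure_mono_null (fun z hz => ?_) h)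
  refine ⟨?_, hz⟩
  have : 0 < ‖z.1 - z.2‖ := norm_pos_iff.2 (sub_ne_zero.2 (hne z hz))
  exact (ENNReal.ofReal_pos.2 (by positivity)).ne'

/-- The set of off-diagonal points where the quotient exceeds its essential supremum is open and
`mu`-null. The density is positive off the diagonal, so this set is empty. -/
theorem holderSeminorm_eq_eLpNorm (hu : Continuous u) :
    holderSeminorm s u = eLpNorm (holderQuotient s u) ∞ (mu N) := by
  rw [eLpNorm_exponent_top]
  refine le_antisymm ?_ ?_
  · have hopen : IsOpen ({z | z.1 ≠ z.2} ∩ (fun z => ‖holderQuotient s u z‖ₑ) ⁻¹'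
        Set.Ioi (eLpNormEssSup (holderQuotient s u) (mu N))) :=
      ContinuousOn.isOpen_inter_preimage
        (continuous_enorm.comp_continuousOn (continuousOn_holderQuotient hu))
        (isOpen_ne_fun continuous_fst continuous_snd) isOpen_Ioi
    have hempty := eq_empty_of_mu_eq_zero hopen (fun z hz => hz.1) <| by
      refine measure_mono_null (fun z hz => ?_)
        (ae_iff.1 (enorm_ae_le_eLpNormEssSup (holderQuotient s u) (mu N)))
      exact not_le.2 hz.2
    refine iSup_le fun x => iSup_le fun y => iSup_le fun hxy => ?_
    rw [← enorm_holderQuotient]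
    by_contra hcon
    exact (Set.eq_empty_iff_forall_notMem.1 hempty (x, y)) ⟨hxy, not_le.1 hcon⟩
  · refine essSup_le_of_ae_le _ (ae_of_all _ fun z => ?_)
    rcases eq_or_ne z.1 z.2 with h | h
    · simp [holderQuotient, h]
    · refine (enorm_holderQuotient z.1 z.2).trans_le ?_
      exact le_iSup_of_le z.1 (le_iSup_of_le z.2 (le_iSup_of_le h le_rfl))

/-- If the energies of `u k` tend to zero and `G k` eventually exceeds `1` beyond each level
`c > 1`, then the Hölder quotients of the limit are at most `1`. -/
theorem ae_abs_holderQuotient_le_one {G : ℕ → ℝ → ℝ} {U V : ℕ → EuclideanSpace ℝ (Fin N) → ℝ}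
    (hG : ∀ k, IsOrlicz (G k)) (hU : ∀ k, MemW s (G k) (U k)) (hV : ∀ k, V k =ᵐ[volume] U k)
    (hE : Tendsto (fun k => ∫ z, G k (holderQuotient s (U k) z) ∂(mu N)) atTop (𝓝 0))
    (hlevel : ∀ c, 1 < c → ∀ᶠ k in atTop, ∀ t, c ≤ |t| → 1 ≤ G k t)
    (hlim : ∀ x, Tendsto (fun k => V k x) atTop (𝓝 (u x))) :
    ∀ᵐ z ∂(mu N), |holderQuotient s u z| ≤ 1 := by
  have hfatou := lintegral_liminf_le' (μ := mu N) (u := atTop)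
    (f := fun k z => ENNReal.ofReal (G k (holderQuotient s (U k) z)))
    (fun k => ((hU k).integrable_holderQuotient (hG k)).1.aemeasurable.ennreal_ofReal)
  have hzero : liminf (fun k => ∫⁻ z, ENNReal.ofReal (G k (holderQuotient s (U k) z)) ∂(mu N))
      atTop = 0 := by
    refine Tendsto.liminf_eq ?_
    have := ENNReal.tendsto_ofReal hE
    rw [ENNReal.ofReal_zero] at this
    refine this.congr fun k => ?_
    exact ofReal_integral_eq_lintegral_ofReal ((hU k).integrable_holderQuotient (hG k))
      (ae_of_all _ fun z => (hG k).nonneg _)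
  have hmeas : AEMeasurable (fun z => liminf
      (fun k => ENNReal.ofReal (G k (holderQuotient s (U k) z))) atTop) (mu N) := by
    simp only [liminf_eq_iSup_iInf_of_nat]
    exact AEMeasurable.iSup fun n => AEMeasurable.biInf _ (Set.to_countable _) fun k _ =>
      ((hU k).integrable_holderQuotient (hG k)).1.aemeasurable.ennreal_ofReal
  rw [hzero, nonpos_iff_eq_zero, lintegral_eq_zero_iff' hmeas] at hfatou
  have hVU : ∀ᵐ z ∂(mu N), ∀ k, holderQuotient s (V k) z = holderQuotient s (U k) z :=
    ae_all_iff.2 fun k => holderQuotient_ae_eq (hV k)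
  filter_upwards [hfatou, hVU] with z hz hzV
  by_contra! hcon
  -- The gap below the limit quotient lets the quotients of `V k` exceed `c` eventually, while `c >
  -- 1` makes `hlevel` available.
  obtain ⟨c, hc1, hc2⟩ := exists_between hcon
  have hD : Tendsto (fun k => |holderQuotient s (V k) z|) atTop (𝓝 |holderQuotient s u z|) :=
    (((hlim z.1).sub (hlim z.2)).div_const _).abs
  have hone : (1 : ℝ≥0∞) ≤
      liminf (fun k => ENNReal.ofReal (G k (holderQuotient s (U k) z))) atTop := by
    refine le_liminf_of_le (by isBoundedDefault) ?_
    filter_upwards [hlevel c hc1, hD.eventually_const_lt hc2] with k hk1 hk2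
    rw [← hzV k]
    exact ENNReal.one_le_ofReal.2 (hk1 _ hk2.le)
  have hz' : liminf (fun k => ENNReal.ofReal (G k (holderQuotient s (U k) z))) atTop = 0 := hz
  rw [hz'] at hone
  exact absurd hone (by simp)

end Seminorm

/-- If `p E ≤ B (1 + E)` with `p ≥ 2 B`, the right-hand side can be absorbed. -/
theorem energy_absorb {p B E : ℝ} (hp : 0 < p) (hE : 0 ≤ E) (hB : 2 * B ≤ p)
    (h : p * E ≤ B * (1 + E)) : E ≤ 2 * B / p ∧ E ≤ 1 := by
  have h1 : p * E ≤ 2 * B := by nlinarith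
  refine ⟨(le_div_iff₀ hp).2 (by linarith), ?_⟩
  by_contra! hcon
  nlinarith

end FracOrlicz

/-! ### Absorption of the energy and passage to the limit. -/

theorem proposition4p4
    (N : ℕ) (hN : 1 ≤ N)
    (Ω : Set (EuclideanSpace ℝ (Fin N)))
    (hΩ_open : IsOpen Ω) (hΩ_bdd : Bornology.IsBounded Ω)
    (hΩ_lip : FracOrlicz.HasLipschitzBoundary Ω)
    (s : ℝ) (hs0 : 0 < s) (hs1 : s < 1)
    (G : ℕ → ℝ → ℝ) (pm pp : ℕ → ℝ) (β : ℝ) (hβ : 1 < β)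
    (hG : ∀ n, FracOrlicz.IsOrlicz (G n))
    (hgrowth : ∀ n, FracOrlicz.HasGrowth (G n) (pm n) (pp n))
    (hpm : Tendsto pm atTop atTop)
    (hpp : ∀ n, pp n ≤ β * pm n)
    (hnorm : Tendsto (fun n => (G n 1) ^ (1 / pm n)) atTop (𝓝 1))
    (r : ℝ≥0∞) (hr : 1 < r)
    (f : EuclideanSpace ℝ (Fin N) → ℝ) (hf : MemLp f r (volume.restrict Ω))
    (u : ℕ → EuclideanSpace ℝ (Fin N) → ℝ)
    (hu : ∀ᶠ n in atTop, FracOrlicz.IsWeakSolution s (G n) Ω f (u n)) :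
    ∃ (φ : ℕ → ℕ) (w : ℕ → EuclideanSpace ℝ (Fin N) → ℝ) (uinf : EuclideanSpace ℝ (Fin N) → ℝ),
      StrictMono φ ∧
      -- `w k` is the continuous representative of `u (φ k)`
      (∀ k, Continuous (w k) ∧ w k =ᵐ[volume] u (φ k) ∧ ∀ x ∉ Ω, w k x = 0) ∧
      TendstoUniformly w uinf atTop ∧
      FracOrlicz.MemHolderSpace s uinf ∧
      (∀ x ∉ Ω, uinf x = 0) ∧
      FracOrlicz.holderSeminorm s uinf =
        eLpNorm (FracOrlicz.holderQuotient s uinf) ∞ (FracOrlicz.mu N) ∧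
      FracOrlicz.holderSeminorm s uinf ≤ 1 := by
  open FracOrlicz in
  have : IsFiniteMeasure (volume.restrict Ω) :=
    isFiniteMeasure_restrict.2 hΩ_bdd.measure_lt_top.ne
  have hf1 : IntegrableOn f Ω := hf.integrable hr.le
  obtain ⟨m, hm⟩ := exists_nat_forall_exists_notMem hN hΩ_bdd
  set H := holderConst N s with hHdef
  have hH : 0 < H := holderConst_pos hs0
  set E : ℕ → ℝ := fun n => ∫ z, G n (holderQuotient s (u n) z) ∂(mu N) with hEdef
  have hE0 : ∀ n, 0 ≤ E n := fun n => integral_nonneg fun z => (hG n).nonneg _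
  set B : ℝ := 2 * (m * H) * ∫ x in Ω, |f x|
  have hs2 : 0 < s / 2 := half_pos hs0
  have main : ∀ᶠ n in atTop, MemW s (G n) (u n) ∧ E n ≤ 2 * B / pm n ∧
      ∃ w : EuclideanSpace ℝ (Fin N) → ℝ, Continuous w ∧ w =ᵐ[volume] u n ∧
        (∀ x ∉ Ω, w x = 0) ∧ (∀ x, |w x| ≤ m * (2 * H)) ∧
        ∀ x y, ‖x - y‖ ≤ 1 → |w x - w y| ≤ 2 * H * ‖x - y‖ ^ (s / 2) := by
    -- The normalization and `pm n ≥ 2N/s` serve the Morrey estimate; `pm n ≥ 2B` serves the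
    -- absorption.
    filter_upwards [hu, hnorm.eventually_const_le (by norm_num : (1 / 2 : ℝ) < 1),
      hpm.eventually_ge_atTop (2 * N / s), hpm.eventually_ge_atTop (2 * B)] with n hn h1 hq hB
    have hw0 := hn.1.1
    obtain ⟨w, hwc, hwu, hwΩ, hw⟩ := hw0.exists_continuous_representative (hgrowth n) (hG n) h1 hN
      hs0 hs1 hq hΩ_open hΩ_lip
    have hw' : ∀ x y, ‖x - y‖ ≤ 1 → |w x - w y| ≤ H * (1 + E n) * ‖x - y‖ ^ (s / 2) := hw
    have hHE : 0 ≤ H * (1 + E n) := mul_nonneg hH.le (by linarith [hE0 n])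
    have hsup := abs_le_of_unit_scale hm hHE hs2.le hwΩ hw'
    -- The sup bound put into the energy estimate itself contains `E n`, but only linearly, so the
    -- large factor `pm n` can absorb it.
    have hen : pm n * E n ≤ 2 * (m * (H * (1 + E n))) * ∫ x in Ω, |f x| :=
      hn.energy_le (hG n) (hgrowth n) hf1 (by filter_upwards [hwu] with x hx; exact hx ▸ hsup x)
    obtain ⟨hEB, hE1⟩ := energy_absorb (hgrowth n).pos (hE0 n) hB (hen.trans_eq (by ring))
    have hH2 : H * (1 + E n) ≤ 2 * H := by nlinarith
    refine ⟨hw0.1, hEB, w, hwc, hwu, hwΩ, fun x => (hsup x).trans ?_,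
      fun x y hxy => (hw' x y hxy).trans ?_⟩
    · gcongr
    · gcongr
  obtain ⟨n₀, hn₀⟩ := eventually_atTop.1 main
  -- Shifting indices by `n₀` makes the estimates hold for every `k`.
  have hge : ∀ k, n₀ ≤ k + n₀ := fun k => Nat.le_add_left _ _
  choose W hWc hWu hWΩ hWb hWH using fun k => (hn₀ (k + n₀) (hge k)).2.2
  obtain ⟨ψ, g, hψ, hg⟩ := exists_subseq_tendstoUniformly hΩ_bdd hs2 hWb hWΩ fun k =>
    abs_sub_le_of_bound_of_unit_scale (by linarith) hs2.le (hWb k) (hWH k)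
  have hφ : StrictMono fun k => ψ k + n₀ := fun a b hab => Nat.add_lt_add_right (hψ hab) _
  have hgc : Continuous g := hg.continuous (Frequently.of_forall fun k => hWc (ψ k))
  have hlim : ∀ x, Tendsto (fun k => W (ψ k) x) atTop (𝓝 (g x)) := fun x => hg.tendsto_at x
  have hE : Tendsto (fun k => E (ψ k + n₀)) atTop (𝓝 0) := by
    have h1 : Tendsto (fun k => 2 * B / pm (ψ k + n₀)) atTop (𝓝 0) :=
      tendsto_const_nhds.div_atTop (hpm.comp hφ.tendsto_atTop)
    exact squeeze_zero (fun k => hE0 _) (fun k => (hn₀ _ (hge (ψ k))).2.1) h1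
  have hlevel : ∀ c : ℝ, 1 < c → ∀ᶠ n in atTop, ∀ t, c ≤ |t| → 1 ≤ G n t := fun c hc => by
    have hc1 : 1 / c < 1 := by rw [div_lt_one (by linarith)]; exact hc
    filter_upwards [hnorm.eventually_const_le hc1] with n hn t ht
    refine le_trans ?_ ((hgrowth n).rpow_le (hG n) hc.le hn ht)
    exact Real.one_le_rpow ((one_le_div (by linarith)).2 ht) (hgrowth n).pos.le
  have hae : ∀ᵐ z ∂(mu N), |holderQuotient s g z| ≤ 1 :=
    ae_abs_holderQuotient_le_one (fun k => hG (ψ k + n₀)) (fun k => (hn₀ _ (hge (ψ k))).1)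
      (fun k => hWu (ψ k)) hE (fun c hc => hφ.tendsto_atTop.eventually (hlevel c hc)) hlim
  have heq : holderSeminorm s g = eLpNorm (holderQuotient s g) ∞ (mu N) :=
    holderSeminorm_eq_eLpNorm hgc
  have hle : holderSeminorm s g ≤ 1 := by
    rw [heq, eLpNorm_exponent_top]
    refine essSup_le_of_ae_le _ ?_
    filter_upwards [hae] with z hz
    rw [Real.enorm_eq_ofReal_abs]
    exact ENNReal.ofReal_le_one.2 hz
  refine ⟨fun k => ψ k + n₀, fun k => W (ψ k), g, hφ,
    fun k => ⟨hWc _, hWu _, hWΩ _⟩, hg, ⟨⟨m * (2 * H), fun x => ?_⟩, hle.trans_lt ENNReal.one_lt_top⟩,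
    fun x hx => ?_, heq, hle⟩
  · exact le_of_tendsto (hlim x).abs (Eventually.of_forall fun k => hWb _ x)
  · refine tendsto_nhds_unique (hlim x) ?_
    simp only [hWΩ _ x hx]
    exact tendsto_const_nhds
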